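/- Let $N\ge 2$ and $K$ be integers, let $e,\varrho\in\mathbb{R}^K$ with $e_k>0$ and $\varrho_k\ge 0$ for all $k$, let $(c_{jk})\in\mathbb{R}^{K\times K}$, and let $\beta>0$. Put $C:=((1-a_{jk})c_{jk})_{jk}$ with $a_{jk}$ the Kronecker delta, $\Lambda:=\mathrm{Diag}(\varrho)$, $\Xi:=\mathrm{Diag}(e)$, let $\langle\cdot,\cdot\rangle$ and $\|\cdot\|_{\mathrm F}$ be the Frobenius inner product and norm, and put $$\mathcal{S}:=\{W\in\mathbb{R}^{K\times K}: We=\mathbf 1,\ W^\top\Xi\varrho=\varrho,\ \mathrm{Tr}(W)=0,\ W\ge 0\}.$$ For $(X_2,\dots,X_N)\in(\mathbb{R}^{K\times K})^{N-1}$ let $$f_\beta(X_2,\dots,X_N):=\sum_{2\le i\le N}\langle X_i,\Lambda\Xi C\Xi\rangle+\sum_{2\le i<j\le N}\langle X_i,\Xi\Lambda X_j\Xi C\Xi\rangle+\beta\sum_{2\le i<j\le N}\langle X_i,X_j\rangle ,$$ and consider the problem $$\min\ f_\beta(X_2,\dots,X_N)\quad\text{s.t.}\quad X_i\in\mathcal{S},\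 i=2,\dots,N.\tag{P}$$ A KKT point of (P) is a point $Z=(X_i)_{i=2}^N\in\mathcal{S}^{N-1}$ for which there are $\lambda_i,\mu_i\in\mathbb{R}^K$, $\nu_i\in\mathbb{R}$ and $\Phi_i\in\mathbb{R}^{K\times K}$ with $\Phi_i\ge 0$, $\langle\Phi_i,X_i\rangle=0$ and $$\nabla_{X_i}f_\beta(Z)=\lambda_i e^\top+\Xi\varrho\,\mu_i^\top+\nu_i I+\Phi_i ,\qquad i=2,\dots,N.$$ Let $\sigma>0$. An exact PBCD sequence is a sequence $Z^{(k)}=(X_i^{(k)})_{i=2}^N\in(\mathbb{R}^{K\times K})^{N-1}$, $k\ge 0$, with arbitrary $Z^{(0)}$, such that for all $k\ge 0$ and $i=2,\dots,N$ the matrix $X_i^{(k+1)}$ is a minimizer over $X_i\in\mathcal{S}$ of $$f_\beta\big(X_2^{(k+1)},\dots,X_{i-1}^{(k+1)},X_i,X_{i+1}^{(k)},\dots,X_N^{(k)}\big)+\frac{\sigma}{2}\|X_i-X_i^{(k)}\|_{\mathrm F}^2 .$$ Then: 1. Every exact PBCD sequence converges to a KKT point of (P). 2. There is $\delta>0$ such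 that every exact PBCD sequence with $Z^{(0)}\in\mathcal{S}^{N-1}$ and $\|Z^{(0)}-Z^*\|_{\mathrm F}<\delta$ for some global minimizer $Z^*$ of (P) converges to a global minimizer of (P). -/

import Mathlib

open Filter Topology

namespace PenalizedMMOT

/-- The Frobenius inner product of two real matrices. -/
def frobInner {m n : ℕ} (X Y : Matrix (Fin m) (Fin n) ℝ) : ℝ :=
  ∑ j, ∑ k, X j k * Y j k

/-- The block variables `(X_2, …, X_N)`, each a real `K × K` matrix. The index `i : Fin (N - 1)`
stands for the block `X_{i+2}`. -/
abbrev Blocks (N K : ℕ) : Type := Fin (N - 1) → Matrix (Fin K) (Fin K) ℝ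

/-- The Frobenius distance between two tuples of blocks. -/
noncomputable def frobDist {N K : ℕ} (Z W : Blocks N K) : ℝ :=
  Real.sqrt (∑ i, frobInner (Z i - W i) (Z i - W i))

/-- The data of the penalized problem of size `K`: the element volumes `e`, the discretized
marginal `rho`, the effective interactions `c` between elements and the penalty parameter `beta`. -/
structure Problem (K : ℕ) where
  e : Fin K → ℝ
  rho : Fin K → ℝ
  c : Matrix (Fin K) (Fin K) ℝ
  beta : ℝ

namespace Problem

variable {N K : ℕ} (P : Problem K)

/-- The interaction matrix `C = ((1 - a_{jk}) c_{jk})_{jk}`, where `a_{jk}` is the Kronecker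
delta. -/
def C : Matrix (Fin K) (Fin K) ℝ :=
  Matrix.of fun j k => (1 - if j = k then 1 else 0) * P.c j k

/-- `Λ = Diag(rho)`. -/
def Lam : Matrix (Fin K) (Fin K) ℝ := Matrix.diagonal P.rho

/-- `Ξ = Diag(e)`. -/
def Xi : Matrix (Fin K) (Fin K) ℝ := Matrix.diagonal P.e

/-- The polytope `S = {W : W e = 1, Wᵀ Ξ rho = rho, Tr W = 0, W ≥ 0}`. -/
def S : Set (Matrix (Fin K) (Fin K) ℝ) :=
  {W | W.mulVec P.e = 1 ∧ (W.transpose * P.Xi).mulVec P.rho = P.rho ∧ W.trace = 0 ∧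
    ∀ j k, 0 ≤ W j k}

/-- The repulsive energy `f`. -/
def energy (Z : Blocks N K) : ℝ :=
  ∑ i, frobInner (Z i) (P.Lam * P.Xi * P.C * P.Xi) +
    ∑ i, ∑ j ∈ Finset.Ioi i, frobInner (Z i) (P.Xi * P.Lam * Z j * P.Xi * P.C * P.Xi)

/-- The penalized energy `f_β`. -/
def penalized (Z : Blocks N K) : ℝ :=
  P.energy Z + P.beta * ∑ i, ∑ j ∈ Finset.Ioi i, frobInner (Z i) (Z j)

/-- `Z ∈ S^{N-1}`. -/
def Feasible (Z : Blocks N K) : Prop := ∀ i, Z i ∈ P.S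

/-- `Z` is a global minimizer of `f_β` over `S^{N-1}`. -/
def IsGlobalMinimizer (Z : Blocks N K) : Prop :=
  P.Feasible Z ∧ ∀ W : Blocks N K, P.Feasible W → P.penalized Z ≤ P.penalized W

/-- The partial gradient of `f_β` with respect to the block `i` at `Z`: its `(j, k)` entry is the
partial derivative of `f_β` with respect to the `(j, k)` entry of that block. -/
noncomputable def blockGrad (Z : Blocks N K) (i : Fin (N - 1)) : Matrix (Fin K) (Fin K) ℝ :=
  Matrix.of fun j k => lineDeriv ℝ P.penalized Z (Pi.single i (Matrix.single j k 1))

/-- `Z` is a KKT point of `min f_β(X_2, …, X_N)` subject to `X_i e = 1`, `X_iᵀ Ξ rho = rho`,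
`Tr X_i = 0`, `X_i ≥ 0`: it is feasible and there are multipliers `l i`, `m i`, `t i` of the
equality constraints and `Phi i ≥ 0` of the sign constraints for which stationarity and
complementary slackness hold. -/
def IsKKT (Z : Blocks N K) : Prop :=
  P.Feasible Z ∧
    ∃ (l m : Fin (N - 1) → Fin K → ℝ) (t : Fin (N - 1) → ℝ) (Phi : Blocks N K),
      (∀ i, P.blockGrad Z i =
        Matrix.vecMulVec (l i) P.e + Matrix.vecMulVec (P.Xi.mulVec P.rho) (m i) +
          t i • (1 : Matrix (Fin K) (Fin K) ℝ) + Phi i) ∧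
      (∀ i j k, 0 ≤ Phi i j k) ∧
      ∀ i, frobInner (Phi i) (Z i) = 0

/-- The objective of the proximal subproblem for the block `i`, where the blocks before `i` are
taken from the new iterate `Znew` and the blocks after `i` from the current iterate `Zold`:
`f_β(Znew_{<i}, X, Zold_{>i}) + (σ / 2) ‖X - Zold_i‖_F²`. -/
noncomputable def blockObjective (σ : ℝ) (Znew Zold : Blocks N K) (i : Fin (N - 1))
    (X : Matrix (Fin K) (Fin K) ℝ) : ℝ :=
  P.penalized (fun j => if j < i then Znew j else if j = i then X else Zold j) +
    σ / 2 * frobInner (X - Zold i) (X - Zold i)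

/-- `Z` is a sequence generated by cyclic proximal block coordinate descent with proximal
parameter `σ` in which all block problems are solved exactly. The initial point `Z 0` is
arbitrary. -/
def IsExactPBCD (σ : ℝ) (Z : ℕ → Blocks N K) : Prop :=
  ∀ k i, Z (k + 1) i ∈ P.S ∧
    ∀ X ∈ P.S, P.blockObjective σ (Z (k + 1)) (Z k) i (Z (k + 1) i) ≤
      P.blockObjective σ (Z (k + 1)) (Z k) i X

end Problem

end PenalizedMMOT

/-! The energy is a quadratic function, and the feasible set is a compact polyhedron. Near a given
point a polyhedron has only finitely many possible active sets, and along each corresponding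
subspace a quadratic's value gap is at most a constant times its squared gradient. This yields a
Łojasiewicz inequality of exponent 1/2 (`exists_eventually_quad_sub_le`). Distinct blocks interact
but no block interacts with itself, so the proximal term supplies the decrease in each step, and
each new iterate is stationary up to a multiple of the step length (`IsExactPBCD.descent`,
`IsExactPBCD.residual`). With the inequality, the value gap then contracts geometrically and the
path has finite length (`exists_tendsto_of_descent`). For part 1 this is applied around a cluster
point; the limit is stationary, and Farkas' lemma supplies the multipliers. For part 2 it is applied
around the global minimizers, with a uniform radius by compactness. -/

namespace PenalizedMMOT

/-! ### Farkas' lemma and generalized inverses. -/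

section Farkas

variable {V ι κ : Type*} [AddCommGroup V] [Module ℝ V]

/-- Farkas' lemma for a finite family of linear functionals. -/
theorem farkas (s : Finset ι) (u : ι → V →ₗ[ℝ] ℝ) (g : V →ₗ[ℝ] ℝ)
    (h : ∀ x, (∀ a ∈ s, 0 ≤ u a x) → 0 ≤ g x) :
    ∃ φ : ι → ℝ, (∀ a, 0 ≤ φ a) ∧ ∀ x, g x = ∑ a ∈ s, φ a * u a x := by
  classical
  induction s using Finset.induction_on generalizing u g with
  | empty =>
    refine ⟨fun _ => 0, fun _ => le_rfl, fun x => ?_⟩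
    have h1 := h x (by simp)
    have h2 := h (-x) (by simp)
    simp only [map_neg] at h2
    simp only [Finset.sum_empty]
    linarith
  | insert a s ha ih =>
    by_cases hs : ∀ x, (∀ i ∈ s, 0 ≤ u i x) → 0 ≤ g x
    · obtain ⟨φ, hφ, hg⟩ := ih u g hs
      refine ⟨Function.update φ a 0, fun i => ?_, fun x => ?_⟩
      · by_cases hi : i = a
        · simp [hi]
        · simpa [hi] using hφ i
      · rw [Finset.sum_insert ha, hg x]
        simp only [Function.update_self, zero_mul, zero_add]
        refine Finset.sum_congr rfl fun i hi => ?_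
        rw [Function.update_of_ne (ne_of_mem_of_not_mem hi ha)]
    · push Not at hs
      obtain ⟨y, hy, hgy⟩ := hs
      have huy : u a y < 0 := by
        by_contra hc
        refine absurd (h y fun i hi => ?_) (not_le.mpr hgy)
        rcases Finset.mem_insert.mp hi with rfl | hi
        · exact not_lt.mp hc
        · exact hy i hi
      -- Since `u a z = -1`, the map `x ↦ x + u a x • z` projects onto the kernel of `u a`. Pulling
      -- everything back along it removes the constraint `a`.
      set z : V := (-(u a y))⁻¹ • y with hz
      have hpos : 0 < (-(u a y))⁻¹ := inv_pos.mpr (by linarith)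
      have haz : u a z = -1 := by
        rw [hz, map_smul, smul_eq_mul, inv_mul_eq_div, div_eq_iff (by linarith)]
        ring
      have hgz : g z ≤ 0 := by
        rw [hz, map_smul, smul_eq_mul]
        nlinarith
      have huz : ∀ i ∈ s, 0 ≤ u i z := fun i hi => by
        rw [hz, map_smul, smul_eq_mul]
        exact mul_nonneg hpos.le (hy i hi)
      obtain ⟨φ, hφ, hg⟩ := ih (fun i => u i + u i z • u a) (g + g z • u a) fun x hx => by
        have := h (x + u a x • z) fun i hi => by
          rcases Finset.mem_insert.mp hi with rfl | hi
          · simp [haz]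
          · simpa [mul_comm] using hx i hi
        simpa [mul_comm] using this
      -- Expanding the pulled-back identity leaves exactly this coefficient of `u a`; it is
      -- nonnegative because `u i z ≥ 0` and `g z ≤ 0`.
      refine ⟨Function.update φ a (∑ i ∈ s, φ i * u i z - g z), fun i => ?_, fun x => ?_⟩
      · by_cases hi : i = a
        · subst hi
          simp only [Function.update_self]
          have := Finset.sum_nonneg fun j hj => mul_nonneg (hφ j) (huz j hj)
          linarith
        · simpa [hi] using hφ i
      · have hx := hg x
        simp only [LinearMap.add_apply, LinearMap.smul_apply, smul_eq_mul, mul_add,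
          Finset.sum_add_distrib] at hx
        rw [Finset.sum_insert ha, Function.update_self]
        have : ∑ i ∈ s, Function.update φ a (∑ i ∈ s, φ i * u i z - g z) i * u i x =
            ∑ i ∈ s, φ i * u i x := Finset.sum_congr rfl fun i hi => by
          rw [Function.update_of_ne (ne_of_mem_of_not_mem hi ha)]
        rw [this, sub_mul, Finset.sum_mul]
        simp only [mul_assoc]
        linarith

/-- Farkas' lemma for finitely many linear equations and inequalities. -/
theorem farkas_eq [Fintype κ] (s : Finset ι) (q : κ → V →ₗ[ℝ] ℝ) (p : ι → V →ₗ[ℝ] ℝ)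
    (g : V →ₗ[ℝ] ℝ) (h : ∀ x, (∀ c, q c x = 0) → (∀ a ∈ s, 0 ≤ p a x) → 0 ≤ g x) :
    ∃ (ψ : κ → ℝ) (φ : ι → ℝ), (∀ a, 0 ≤ φ a) ∧
      ∀ x, g x = ∑ c, ψ c * q c x + ∑ a ∈ s, φ a * p a x := by
  obtain ⟨φ, hφ, hg⟩ := farkas ((Finset.univ : Finset (κ ⊕ κ)).disjSum s)
    (Sum.elim (Sum.elim q fun c => -q c) p) g fun x hx => h x
      (fun c => le_antisymm (by simpa using hx (.inl (.inr c)) (by simp))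
        (by simpa using hx (.inl (.inl c)) (by simp)))
      fun a ha => by simpa using hx (.inr a) (by simpa using ha)
  refine ⟨fun c => φ (.inl (.inl c)) - φ (.inl (.inr c)), fun a => φ (.inr a), fun a => hφ _,
    fun x => ?_⟩
  rw [hg x, Finset.sum_disjSum, Fintype.sum_sum_type]
  simp [sub_mul, ← sub_eq_add_neg]

end Farkas

/-- A linear section of the map onto its range extends to all of `W`. It serves to replace a vector
by one with the same image and controlled norm, even when `φ` has a kernel. -/
theorem exists_generalized_inverse {V W : Type*} [AddCommGroup V] [Module ℝ V] [AddCommGroup W]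
    [Module ℝ W] (φ : V →ₗ[ℝ] W) : ∃ ψ : W →ₗ[ℝ] V, ∀ x, φ (ψ (φ x)) = φ x := by
  obtain ⟨ψ, hψ⟩ := φ.rangeRestrict.exists_rightInverse_of_surjective φ.range_rangeRestrict
  obtain ⟨ψ', hψ'⟩ := ψ.exists_extend
  refine ⟨ψ', fun x => ?_⟩
  have h1 : ψ' (φ x) = ψ (φ.rangeRestrict x) := LinearMap.congr_fun hψ' (φ.rangeRestrict x)
  rw [h1]
  exact congrArg Subtype.val (LinearMap.congr_fun hψ (φ.rangeRestrict x))

/-! ### Quadratic functions along a subspace. -/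

section Quadratic

variable {E : Type*} [NormedAddCommGroup E] [NormedSpace ℝ E]

/-- The quadratic function with linear part `l` and Hessian `B`. -/
noncomputable def quad (l : E →L[ℝ] ℝ) (B : E →L[ℝ] E →L[ℝ] ℝ) (x : E) : ℝ :=
  l x + 1 / 2 * B x x

variable {l : E →L[ℝ] ℝ} {B : E →L[ℝ] E →L[ℝ] ℝ}

theorem quad_add (hB : ∀ x y, B x y = B y x) (x d : E) :
    quad l B (x + d) = quad l B x + (l d + B x d) + 1 / 2 * B d d := by
  simp only [quad, map_add, add_apply, hB d x]
  ring

theorem continuous_quad : Continuous (quad l B) := by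
  unfold quad
  fun_prop

variable [FiniteDimensional ℝ E]

/-- The value of a quadratic form is bounded by the square of the norm of its gradient. -/
theorem exists_abs_form_le {V : Type*} [NormedAddCommGroup V] [NormedSpace ℝ V]
    [FiniteDimensional ℝ V] {B : V →ₗ[ℝ] V →ₗ[ℝ] ℝ} (hB : ∀ x y, B x y = B y x) :
    ∃ c : ℝ, 0 ≤ c ∧ ∀ z R, 0 ≤ R → (∀ d, |B z d| ≤ R * ‖d‖) → |B z z| ≤ c * R ^ 2 := by
  let φ : V →ₗ[ℝ] (V →L[ℝ] ℝ) := (LinearMap.toContinuousLinearMap (𝕜 := ℝ)).toLinearMap ∘ₗ B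
  obtain ⟨ψ, hψ⟩ := exists_generalized_inverse φ
  let ψ' := LinearMap.toContinuousLinearMap ψ
  refine ⟨‖ψ'‖, ψ'.opNorm_nonneg, fun z R hR hd => ?_⟩
  have hnorm : ‖φ z‖ ≤ R := ContinuousLinearMap.opNorm_le_bound _ hR hd
  -- `w` has the same gradient as `z`, but its norm is bounded by that gradient; by symmetry `B z z
  -- = B z w`.
  let w : V := ψ' (φ z)
  have hw : φ w = φ z := hψ z
  have hwn : ‖w‖ ≤ ‖ψ'‖ * R := (ψ'.le_opNorm _).trans (by gcongr)
  have h1 : B z z = B z w := by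
    have h2 : B w z = B z z := congrArg (fun g : V →L[ℝ] ℝ => g z) hw
    rw [← h2, hB]
  rw [h1]
  calc |B z w| ≤ R * ‖w‖ := hd w
    _ ≤ R * (‖ψ'‖ * R) := by gcongr
    _ = ‖ψ'‖ * R ^ 2 := by ring

/-- If `z₀` is stationary along `D`, the gap is half the form at `z - z₀`, whose gradient on `D` is
that of the function at `z`, so `exists_abs_form_le` applies. Otherwise the gradient along some `d ∈
D` stays away from zero near `z₀`; then `R` is bounded below and a large constant absorbs a gap
below 1. -/
theorem exists_eventually_quad_sub_le_of_submodule (hB : ∀ x y, B x y = B y x)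
    (D : Submodule ℝ E) (z₀ : E) :
    ∃ c : ℝ, 0 ≤ c ∧ ∀ᶠ z in 𝓝 z₀, z - z₀ ∈ D → ∀ R : ℝ, 0 ≤ R →
      (∀ d ∈ D, |l d + B z d| ≤ R * ‖d‖) → quad l B z - quad l B z₀ ≤ c * R ^ 2 := by
  by_cases h0 : ∀ d ∈ D, l d + B z₀ d = 0
  · obtain ⟨c, hc, h⟩ := exists_abs_form_le
      (B := LinearMap.mk₂ ℝ (fun x y : D => B x y) (by simp) (by simp) (by simp) (by simp))
      fun x y => hB x y
    refine ⟨c, hc, Eventually.of_forall fun z hz R hR hd => ?_⟩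
    have h1 := h ⟨_, hz⟩ R hR fun ⟨d, hdD⟩ => by
      have h2 := h0 d hdD
      have h3 : B (z - z₀) d = l d + B z d := by
        simp only [map_sub, sub_apply]
        linarith
      change |B (z - z₀) d| ≤ R * ‖d‖
      rw [h3]
      exact hd d hdD
    change |B (z - z₀) (z - z₀)| ≤ c * R ^ 2 at h1
    have h2 := quad_add (l := l) hB z₀ (z - z₀)
    rw [h0 _ hz, add_sub_cancel] at h2
    have h3 := abs_le.mp h1
    have h4 : 0 ≤ c * R ^ 2 := by positivity
    linarith [h3.2]
  · push Not at h0
    obtain ⟨d, hdD, hd⟩ := h0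
    have hpos : 0 < |l d + B z₀ d| := abs_pos.mpr hd
    have hdn : 0 < ‖d‖ := norm_pos_iff.mpr fun h => hd (by simp [h])
    set η := |l d + B z₀ d| / 2 with hη
    have hη0 : 0 < η := by positivity
    have hc1 : Continuous fun z => |l d + B z d| := by fun_prop
    have e1 : ∀ᶠ z in 𝓝 z₀, η < |l d + B z d| :=
      hc1.continuousAt.eventually (lt_mem_nhds (by linarith))
    have e2 : ∀ᶠ z in 𝓝 z₀, quad l B z < quad l B z₀ + 1 :=
      continuous_quad.continuousAt.eventually (gt_mem_nhds (by linarith))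
    refine ⟨‖d‖ ^ 2 / η ^ 2, by positivity, ?_⟩
    filter_upwards [e1, e2] with z h1 h2 _ R hR hR'
    have h3 : η ≤ R * ‖d‖ := h1.le.trans (hR' d hdD)
    have h4 : 1 ≤ ‖d‖ ^ 2 / η ^ 2 * R ^ 2 := by
      rw [div_mul_eq_mul_div, le_div_iff₀ (by positivity), one_mul, ← mul_pow, mul_comm ‖d‖]
      gcongr
    linarith

end Quadratic

/-! ### The Łojasiewicz inequality on a polyhedron. -/

section Polyhedron

variable {E ι κ : Type*} [NormedAddCommGroup E] [NormedSpace ℝ E]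

/-- The polyhedron of all `x` with `q c x = b c` for all `c` and `0 ≤ p a x` for all `a`. -/
def polyhedron (q : κ → E →ₗ[ℝ] ℝ) (b : κ → ℝ) (p : ι → E →ₗ[ℝ] ℝ) : Set E :=
  {x | (∀ c, q c x = b c) ∧ ∀ a, 0 ≤ p a x}

variable {q : κ → E →ₗ[ℝ] ℝ} {b : κ → ℝ} {p : ι → E →ₗ[ℝ] ℝ}

/-- The finitely many inactive inequalities are strict at `z` and survive a short step; the active
ones do not decrease along `d`. -/
theorem exists_pos_add_smul_mem_polyhedron [Finite ι] {z d : E}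
    (hz : z ∈ polyhedron q b p) (hq : ∀ c, q c d = 0) (hp : ∀ a, p a z = 0 → 0 ≤ p a d) :
    ∃ t : ℝ, 0 < t ∧ z + t • d ∈ polyhedron q b p := by
  have h : ∀ᶠ t : ℝ in 𝓝[>] 0, ∀ a, 0 ≤ p a z + t * p a d := by
    refine eventually_all.mpr fun a => ?_
    rcases (hz.2 a).eq_or_lt with h0 | h0
    · filter_upwards [self_mem_nhdsWithin] with t ht
      rw [← h0, zero_add]
      exact mul_nonneg (le_of_lt ht) (hp a h0.symm)
    · have hc : Continuous fun t : ℝ => p a z + t * p a d := by fun_prop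
      refine (hc.continuousAt.eventually (lt_mem_nhds (a := 0) (by simpa using h0))).filter_mono
        nhdsWithin_le_nhds |>.mono fun t ht => le_of_lt ht
  obtain ⟨t, ht, ht0⟩ := (h.and self_mem_nhdsWithin).exists
  exact ⟨t, ht0, fun c => by simp [hz.1 c, hq c], fun a => by simpa using ht a⟩

/-- The Kurdyka–Łojasiewicz inequality with exponent `1 / 2` for a quadratic function on a
polyhedron. -/
theorem exists_eventually_quad_sub_le [Finite ι] [FiniteDimensional ℝ E]
    {l : E →L[ℝ] ℝ} {B : E →L[ℝ] E →L[ℝ] ℝ} (hB : ∀ x y, B x y = B y x) {z₀ : E}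
    (hz₀ : z₀ ∈ polyhedron q b p) :
    ∃ c : ℝ, 0 ≤ c ∧ ∀ᶠ z in 𝓝 z₀, z ∈ polyhedron q b p → ∀ R : ℝ, 0 ≤ R →
      (∀ w ∈ polyhedron q b p, -(R * ‖w - z‖) ≤ l (w - z) + B z (w - z)) →
      quad l B z - quad l B z₀ ≤ c * R ^ 2 := by
  classical
  have := Fintype.ofFinite ι
  let D : Finset ι → Submodule ℝ E := fun J =>
    (⨅ c, LinearMap.ker (q c)) ⊓ ⨅ a ∈ J, LinearMap.ker (p a)
  have hD : ∀ J d, d ∈ D J ↔ (∀ c, q c d = 0) ∧ ∀ a ∈ J, p a d = 0 := fun J d => by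
    simp [D]
  -- The active set of `z` varies with `z`, so all index sets `J` are treated at once and the
  -- constants added.
  choose c hc h using fun J => exists_eventually_quad_sub_le_of_submodule (l := l) hB (D J) z₀
  refine ⟨∑ J, c J, Finset.sum_nonneg fun J _ => hc J, ?_⟩
  have e : ∀ᶠ z in 𝓝 z₀, ∀ a, 0 < p a z₀ → 0 < p a z := by
    refine eventually_all.mpr fun a => ?_
    by_cases h0 : 0 < p a z₀
    · exact ((p a).continuous_of_finiteDimensional.continuousAt.eventually
        (lt_mem_nhds h0)).mono fun z hz _ => hz
    · exact Eventually.of_forall fun z hz => absurd hz h0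
  filter_upwards [eventually_all.mpr h, e] with z hz hpos hzF R hR hw
  let J : Finset ι := Finset.univ.filter fun a => p a z = 0
  -- Constraints inactive at `z₀` remain inactive nearby, so those active at `z` are active at `z₀`
  -- too.
  have hzD : z - z₀ ∈ D J := by
    refine (hD J _).mpr ⟨fun c => by simp [hzF.1 c, hz₀.1 c], fun a ha => ?_⟩
    have ha0 : p a z = 0 := by simpa [J] using ha
    have : p a z₀ = 0 := le_antisymm (not_lt.mp fun h0 => (hpos a h0).ne' ha0) (hz₀.2 a)
    simp [ha0, this]
  -- Both `d` and `-d` are feasible directions at `z`, so the one-sided residual bound becomes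
  -- two-sided on `D J`.
  have key : ∀ d ∈ D J, -(R * ‖d‖) ≤ l d + B z d := fun d hd => by
    obtain ⟨hq, hp⟩ := (hD J d).mp hd
    obtain ⟨t, ht, hmem⟩ := exists_pos_add_smul_mem_polyhedron hzF hq fun a ha =>
      (hp a (by simpa [J] using ha)).ge
    have h1 := hw _ hmem
    simp only [add_sub_cancel_left, norm_smul, map_smul, smul_eq_mul, Real.norm_eq_abs,
      abs_of_pos ht] at h1
    exact le_of_mul_le_mul_left (by linarith : t * -(R * ‖d‖) ≤ t * (l d + B z d)) ht
  refine (hz J hzD R hR fun d hd => abs_le.mpr ⟨key d hd, ?_⟩).trans ?_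
  · have h1 := key (-d) (neg_mem hd)
    simp only [norm_neg, map_neg] at h1
    linarith
  · gcongr
    exact Finset.single_le_sum (fun J _ => hc J) (Finset.mem_univ J)

end Polyhedron

/-! ### Finite length of descent sequences. -/

section Descent

variable {E : Type*} [NormedAddCommGroup E] [CompleteSpace E]

/-- A descent sequence that starts close to a point near which the value gap is bounded by the
squared step length stays near that point and converges. -/
theorem exists_tendsto_of_descent (g : E → ℝ) (z₀ : E) {a C ε : ℝ} (ha : 0 < a) (hC : 0 ≤ C)
    (hε : 0 < ε) :
    ∃ η : ℝ, 0 < η ∧ ∀ z : ℕ → E,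
      (∀ k, g (z (k + 1)) + a * ‖z (k + 1) - z k‖ ^ 2 ≤ g (z k)) →
      (∀ k, dist (z (k + 1)) z₀ < ε → g (z (k + 1)) - g z₀ ≤ C * ‖z (k + 1) - z k‖ ^ 2) →
      (∀ k, g z₀ ≤ g (z k)) → dist (z 0) z₀ < η → g (z 0) - g z₀ < η →
      ∃ x, Tendsto z atTop (𝓝 x) ∧ Tendsto (fun k => g (z k)) atTop (𝓝 (g z₀)) := by
  -- Combining descent with the gap bound gives `(C + a) Δ (k + 1) ≤ C Δ k`, so `√Δ` contracts by
  -- `θ`.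
  set θ := Real.sqrt (C / (C + a)) with hθ
  have hθ0 : 0 ≤ θ := Real.sqrt_nonneg _
  have hθ1 : θ < 1 := by
    rw [hθ, Real.sqrt_lt' one_pos, one_pow, div_lt_one (by linarith)]
    linarith
  set M := 1 / Real.sqrt a with hM
  have hM0 : 0 < M := by positivity
  -- The second term keeps the total path length, at most `M √(Δ 0) / (1 - θ)`, below `ε / 2`; the
  -- first leaves the other half for the initial distance.
  refine ⟨min (ε / 2) ((ε * (1 - θ) / (2 * M)) ^ 2), lt_min (by positivity) ?_,
    fun z hdesc hkl hlow hz0 hg0 => ?_⟩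
  · have : 0 < 1 - θ := by linarith
    positivity
  set Δ : ℕ → ℝ := fun k => g (z k) - g z₀ with hΔ
  have hΔ0 : ∀ k, 0 ≤ Δ k := fun k => sub_nonneg.mpr (hlow k)
  have hstep : ∀ k, ‖z (k + 1) - z k‖ ≤ M * Real.sqrt (Δ k) := fun k => by
    have h1 : ‖z (k + 1) - z k‖ ^ 2 ≤ Δ k / a := by
      rw [le_div_iff₀ ha]
      have := hdesc k
      have := hΔ0 (k + 1)
      simp only [hΔ] at *
      linarith
    calc ‖z (k + 1) - z k‖ ≤ Real.sqrt (Δ k / a) := Real.le_sqrt_of_sq_le h1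
      _ = M * Real.sqrt (Δ k) := by rw [Real.sqrt_div (hΔ0 k), hM]; ring
  have hdecay : ∀ k, dist (z (k + 1)) z₀ < ε → Real.sqrt (Δ (k + 1)) ≤ θ * Real.sqrt (Δ k) := by
    intro k hk
    rw [hθ, ← Real.sqrt_mul (by positivity)]
    refine Real.sqrt_le_sqrt ?_
    rw [div_mul_eq_mul_div, le_div_iff₀ (by linarith)]
    have h1 := hdesc k
    have h2 := hkl k hk
    have h3 : a * Δ (k + 1) ≤ a * (C * ‖z (k + 1) - z k‖ ^ 2) := by gcongr
    have h4 : C * (a * ‖z (k + 1) - z k‖ ^ 2) ≤ C * (Δ k - Δ (k + 1)) := by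
      gcongr
      simp only [hΔ]
      linarith
    nlinarith
  have hs0 : Real.sqrt (Δ 0) < ε * (1 - θ) / (2 * M) := by
    have : 0 < 1 - θ := by linarith
    rw [Real.sqrt_lt' (by positivity)]
    exact hg0.trans_le (min_le_right _ _)
  have hgeom : ∀ k, M * Real.sqrt (Δ 0) * ∑ j ∈ Finset.range k, θ ^ j < ε / 2 := fun k => by
    have h1 : ∑ j ∈ Finset.range k, θ ^ j ≤ (1 - θ)⁻¹ := by
      rw [← tsum_geometric_of_lt_one hθ0 hθ1]
      exact (summable_geometric_of_lt_one hθ0 hθ1).sum_le_tsum _ fun j _ => by positivity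
    have h2 : 0 < 1 - θ := by linarith
    calc M * Real.sqrt (Δ 0) * ∑ j ∈ Finset.range k, θ ^ j
        ≤ M * Real.sqrt (Δ 0) * (1 - θ)⁻¹ := by gcongr
      _ < M * (ε * (1 - θ) / (2 * M)) * (1 - θ)⁻¹ := by gcongr
      _ = ε / 2 := by field_simp
  -- The bounds need each other: decay so far keeps the next iterate in the `ε`-ball, where the next
  -- contraction is available.
  have hind : ∀ k, Real.sqrt (Δ k) ≤ θ ^ k * Real.sqrt (Δ 0) ∧
      dist (z k) (z 0) ≤ M * Real.sqrt (Δ 0) * ∑ j ∈ Finset.range k, θ ^ j := by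
    intro k
    induction k with
    | zero => simp
    | succ k ih =>
      have h1 : dist (z (k + 1)) (z 0) ≤
          M * Real.sqrt (Δ 0) * ∑ j ∈ Finset.range (k + 1), θ ^ j := by
        rw [Finset.sum_range_succ, mul_add]
        have h2 := dist_triangle (z (k + 1)) (z k) (z 0)
        have h3 : dist (z (k + 1)) (z k) ≤ M * (θ ^ k * Real.sqrt (Δ 0)) := by
          rw [dist_eq_norm]
          exact (hstep k).trans (by gcongr; exact ih.1)
        linarith [ih.2]
      refine ⟨?_, h1⟩
      have h2 : dist (z (k + 1)) z₀ < ε := by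
        have h3 := dist_triangle (z (k + 1)) (z 0) z₀
        have h4 := hz0.trans_le (min_le_left _ _)
        linarith [hgeom (k + 1)]
      calc Real.sqrt (Δ (k + 1)) ≤ θ * Real.sqrt (Δ k) := hdecay k h2
        _ ≤ θ * (θ ^ k * Real.sqrt (Δ 0)) := by gcongr; exact ih.1
        _ = θ ^ (k + 1) * Real.sqrt (Δ 0) := by ring
  have hcauchy : CauchySeq z := by
    refine cauchySeq_of_le_geometric θ (M * Real.sqrt (Δ 0)) hθ1 fun k => ?_
    rw [dist_comm, dist_eq_norm]
    refine (hstep k).trans ?_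
    have := mul_le_mul_of_nonneg_left (hind k).1 hM0.le
    linarith
  obtain ⟨x, hx⟩ := cauchySeq_tendsto_of_complete hcauchy
  refine ⟨x, hx, ?_⟩
  have h1 : Tendsto (fun k => Real.sqrt (Δ k)) atTop (𝓝 0) := by
    refine squeeze_zero (fun k => Real.sqrt_nonneg _) (fun k => (hind k).1) ?_
    simpa using (tendsto_pow_atTop_nhds_zero_of_lt_one hθ0 hθ1).mul_const (Real.sqrt (Δ 0))
  have h2 : Tendsto Δ atTop (𝓝 0) := by
    have h3 := h1.pow 2
    simpa only [Real.sq_sqrt (hΔ0 _), ne_eq, OfNat.ofNat_ne_zero, not_false_eq_true,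
      zero_pow] using h3
  simpa [hΔ] using h2.add_const (g z₀)

end Descent

/-! ### Descent sequences on a compact polyhedron. -/

section Convergence

variable {E : Type*} [NormedAddCommGroup E] [NormedSpace ℝ E]

/-- A sequence in `F` along which the quadratic function with data `l`, `B` decreases
sufficiently and the stationarity residual is bounded by the step length. -/
structure IsDescentSeq (F : Set E) (l : E →L[ℝ] ℝ) (B : E →L[ℝ] E →L[ℝ] ℝ) (a L : ℝ)
    (z : ℕ → E) : Prop where
  mem : ∀ k, z k ∈ F
  descent : ∀ k, quad l B (z (k + 1)) + a * ‖z (k + 1) - z k‖ ^ 2 ≤ quad l B (z k)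
  residual : ∀ k, ∀ w ∈ F, -(L * ‖z (k + 1) - z k‖ * ‖w - z (k + 1)‖) ≤
    l (w - z (k + 1)) + B (z (k + 1)) (w - z (k + 1))

variable {F : Set E} {l : E →L[ℝ] ℝ} {B : E →L[ℝ] E →L[ℝ] ℝ} {a L : ℝ}

theorem IsDescentSeq.shift {z : ℕ → E} (h : IsDescentSeq F l B a L z) (m : ℕ) :
    IsDescentSeq F l B a L fun k => z (k + m) where
  mem k := h.mem _
  descent k := by simpa only [Nat.add_right_comm] using h.descent (k + m)
  residual k := by simpa only [Nat.add_right_comm] using h.residual (k + m)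

variable {ι κ : Type*} [Finite ι] {q : κ → E →ₗ[ℝ] ℝ} {b : κ → ℝ} {p : ι → E →ₗ[ℝ] ℝ}
  [FiniteDimensional ℝ E]

/-- The Łojasiewicz inequality with `R = L ‖z (k + 1) - z k‖` turns the residual bound into the gap
bound of `exists_tendsto_of_descent`, with `C = c L²`. -/
theorem exists_tendsto_of_isDescentSeq (hB : ∀ x y, B x y = B y x) (ha : 0 < a) (hL : 0 ≤ L)
    {z₀ : E} (hz₀ : z₀ ∈ polyhedron q b p) :
    ∃ η : ℝ, 0 < η ∧ ∀ z : ℕ → E, IsDescentSeq (polyhedron q b p) l B a L z →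
      (∀ k, quad l B z₀ ≤ quad l B (z k)) → dist (z 0) z₀ < η →
      quad l B (z 0) - quad l B z₀ < η →
      ∃ x, Tendsto z atTop (𝓝 x) ∧ Tendsto (fun k => quad l B (z k)) atTop (𝓝 (quad l B z₀)) := by
  have : CompleteSpace E := FiniteDimensional.complete ℝ E
  obtain ⟨c, hc, hev⟩ := exists_eventually_quad_sub_le (l := l) hB hz₀
  obtain ⟨ε, hε, hball⟩ := Metric.eventually_nhds_iff.mp hev
  obtain ⟨η, hη, h⟩ := exists_tendsto_of_descent (quad l B) z₀ ha
    (by positivity : 0 ≤ c * L ^ 2) hε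
  refine ⟨η, hη, fun z hz hlow h0 h1 => h z hz.descent (fun k hk => ?_) hlow h0 h1⟩
  have := hball hk (hz.mem _) (L * ‖z (k + 1) - z k‖) (by positivity) (hz.residual k)
  linarith [mul_pow L ‖z (k + 1) - z k‖ 2]

/-- On a compact polyhedron, every descent sequence converges to a stationary point. -/
theorem IsDescentSeq.exists_tendsto (hF : IsCompact (polyhedron q b p))
    (hB : ∀ x y, B x y = B y x) (ha : 0 < a) (hL : 0 ≤ L) {z : ℕ → E}
    (hz : IsDescentSeq (polyhedron q b p) l B a L z) :
    ∃ x ∈ polyhedron q b p, Tendsto z atTop (𝓝 x) ∧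
      ∀ w ∈ polyhedron q b p, 0 ≤ l (w - x) + B x (w - x) := by
  obtain ⟨z₀, hz₀, φ, hφ, hlim⟩ := hF.tendsto_subseq hz.mem
  have hanti : Antitone fun k => quad l B (z k) := antitone_nat_of_succ_le fun k => by
    have := hz.descent k
    have : 0 ≤ a * ‖z (k + 1) - z k‖ ^ 2 := by positivity
    linarith
  have hqlim : Tendsto (fun k => quad l B (z (φ k))) atTop (𝓝 (quad l B z₀)) :=
    (continuous_quad.tendsto z₀).comp hlim
  have hlow : ∀ k, quad l B z₀ ≤ quad l B (z k) := fun k =>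
    le_of_tendsto hqlim <| (eventually_ge_atTop k).mono fun j hj =>
      hanti (hj.trans (hφ.le_apply (x := j)))
  obtain ⟨η, hη, h⟩ := exists_tendsto_of_isDescentSeq (l := l) hB ha hL hz₀
  have e1 : ∀ᶠ k in atTop, dist (z (φ k)) z₀ < η := hlim.eventually (Metric.ball_mem_nhds _ hη)
  have e2 : ∀ᶠ k in atTop, quad l B (z (φ k)) < quad l B z₀ + η :=
    hqlim.eventually (gt_mem_nhds (by linarith))
  -- A late term of the subsequence is close to the cluster point in position and value; the tail
  -- starting there converges.
  obtain ⟨k, hk1, hk2⟩ := (e1.and e2).exists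
  obtain ⟨x, hx, -⟩ := h _ (hz.shift (φ k)) (fun j => hlow _) (by simpa using hk1)
    (by simp only [zero_add]; linarith)
  have hx' : Tendsto z atTop (𝓝 x) := (tendsto_add_atTop_iff_nat (φ k)).mp hx
  have hx1 : Tendsto (fun k => z (k + 1)) atTop (𝓝 x) := (tendsto_add_atTop_iff_nat 1).mpr hx'
  refine ⟨x, hF.isClosed.mem_of_tendsto hx' (Eventually.of_forall hz.mem), hx', fun w hw => ?_⟩
  have hl : Tendsto (fun k => -(L * ‖z (k + 1) - z k‖ * ‖w - z (k + 1)‖)) atTop (𝓝 0) := by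
    simpa using ((((hx1.sub hx').norm).const_mul L).mul ((tendsto_const_nhds.sub hx1).norm
      (a := w - x))).neg
  have hcont : Continuous fun y => l (w - y) + B y (w - y) := by fun_prop
  exact le_of_tendsto_of_tendsto' hl ((hcont.tendsto x).comp hx1) fun k => hz.residual k w hw

/-- On a compact polyhedron, every descent sequence that starts near a global minimizer converges
to a global minimizer. -/
theorem exists_tendsto_isMinOn (hF : IsCompact (polyhedron q b p))
    (hB : ∀ x y, B x y = B y x) (ha : 0 < a) (hL : 0 ≤ L) :
    ∃ δ : ℝ, 0 < δ ∧ ∀ z : ℕ → E, IsDescentSeq (polyhedron q b p) l B a L z →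
      (∃ y ∈ polyhedron q b p, IsMinOn (quad l B) (polyhedron q b p) y ∧ dist (z 0) y < δ) →
      ∃ x ∈ polyhedron q b p, IsMinOn (quad l B) (polyhedron q b p) x ∧
        Tendsto z atTop (𝓝 x) := by
  set F := polyhedron q b p
  let A : Set E := {y | y ∈ F ∧ IsMinOn (quad l B) F y}
  have hA : IsCompact A := by
    have : A = F ∩ ⋂ w ∈ F, {y | quad l B y ≤ quad l B w} := by
      ext y
      simp [A, IsMinOn, IsMinFilter]
    rw [this]
    exact hF.inter_right (isClosed_biInter fun w _ =>
      isClosed_le continuous_quad continuous_const)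
  choose η hη h using fun y : A => exists_tendsto_of_isDescentSeq (l := l) hB ha hL y.2.1
  -- Each minimizer has its own radius; a Lebesgue number of this cover makes it uniform. The
  -- minimizer `y'` obtained below may differ from `y`.
  obtain ⟨δ, hδ, hball⟩ := lebesgue_number_lemma_of_metric hA
    (c := fun y : A => Metric.ball y.1 (η y) ∩ {x | quad l B x < quad l B y.1 + η y})
    (fun y => Metric.isOpen_ball.inter (isOpen_lt continuous_quad continuous_const))
    fun y hy => Set.mem_iUnion.mpr ⟨⟨y, hy⟩, Metric.mem_ball_self (hη _), by
      simpa using hη ⟨y, hy⟩⟩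
  refine ⟨δ, hδ, fun z hz ⟨y, hyF, hy, hd⟩ => ?_⟩
  obtain ⟨⟨y', hy'⟩, hsub⟩ := hball y ⟨hyF, hy⟩
  obtain ⟨h1, h2⟩ := hsub hd
  obtain ⟨x, hx, hq⟩ := h ⟨y', hy'⟩ z hz (fun k => hy'.2 (hz.mem k)) h1
    (by simp only [Set.mem_ofPred_eq] at h2; linarith)
  have hval : quad l B x = quad l B y' :=
    tendsto_nhds_unique ((continuous_quad.tendsto x).comp hx) hq
  refine ⟨x, hF.isClosed.mem_of_tendsto hx (Eventually.of_forall hz.mem), fun w hw => ?_, hx⟩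
  rw [Set.mem_ofPred_eq, hval]
  exact hy'.2 hw

end Convergence

end PenalizedMMOT

namespace PenalizedMMOT

/-! ### The block problem in the entrywise maximum norm. -/

section Blocks

attribute [-instance] instTopologicalSpaceMatrix Matrix.instUniformSpace
attribute [local instance] Matrix.normedAddCommGroup Matrix.normedSpace

variable {m n N K : ℕ}

/-- The Frobenius inner product as a bilinear map. -/
def frobBilin (m n : ℕ) :
    Matrix (Fin m) (Fin n) ℝ →ₗ[ℝ] Matrix (Fin m) (Fin n) ℝ →ₗ[ℝ] ℝ :=
  LinearMap.mk₂ ℝ frobInner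
    (fun X X' Y => by simp [frobInner, add_mul, Finset.sum_add_distrib])
    (fun c X Y => by simp [frobInner, Finset.mul_sum, mul_assoc])
    (fun X Y Y' => by simp [frobInner, mul_add, Finset.sum_add_distrib])
    (fun c X Y => by simp [frobInner, Finset.mul_sum, mul_left_comm])

@[simp]
theorem frobBilin_apply (X Y : Matrix (Fin m) (Fin n) ℝ) : frobBilin m n X Y = frobInner X Y :=
  rfl

theorem frobInner_comm (X Y : Matrix (Fin m) (Fin n) ℝ) : frobInner X Y = frobInner Y X := by
  simp only [frobInner, mul_comm]

theorem frobInner_self_add_smul (X Y : Matrix (Fin m) (Fin n) ℝ) (t : ℝ) :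
    frobInner (X + t • Y) (X + t • Y) =
      frobInner X X + 2 * t * frobInner X Y + t ^ 2 * frobInner Y Y := by
  simp only [← frobBilin_apply, map_add, map_smul, LinearMap.add_apply, LinearMap.smul_apply,
    smul_eq_mul]
  rw [frobBilin_apply Y X, frobInner_comm Y X, ← frobBilin_apply]
  ring

theorem frobInner_self_nonneg (X : Matrix (Fin m) (Fin n) ℝ) : 0 ≤ frobInner X X :=
  Finset.sum_nonneg fun _ _ => Finset.sum_nonneg fun _ _ => mul_self_nonneg _

theorem norm_sq_le_frobInner (X : Matrix (Fin m) (Fin n) ℝ) : ‖X‖ ^ 2 ≤ frobInner X X := by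
  refine (Real.le_sqrt (norm_nonneg _) (frobInner_self_nonneg X)).mp ?_
  refine (Matrix.norm_le_iff (Real.sqrt_nonneg _)).mpr fun j k => Real.le_sqrt_of_sq_le ?_
  rw [Real.norm_eq_abs, sq_abs, sq]
  calc X j k * X j k ≤ ∑ k, X j k * X j k :=
        Finset.single_le_sum (f := fun k => X j k * X j k) (fun _ _ => mul_self_nonneg _)
          (Finset.mem_univ k)
    _ ≤ frobInner X X :=
        Finset.single_le_sum (f := fun j => ∑ k, X j k * X j k)
          (fun _ _ => Finset.sum_nonneg fun _ _ => mul_self_nonneg _) (Finset.mem_univ j)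

theorem abs_frobInner_le (X Y : Matrix (Fin m) (Fin n) ℝ) :
    |frobInner X Y| ≤ m * n * (‖X‖ * ‖Y‖) := by
  calc |frobInner X Y| ≤ ∑ _j : Fin m, ∑ _k : Fin n, ‖X‖ * ‖Y‖ := by
        refine (Finset.abs_sum_le_sum_abs _ _).trans (Finset.sum_le_sum fun j _ => ?_)
        refine (Finset.abs_sum_le_sum_abs _ _).trans (Finset.sum_le_sum fun k _ => ?_)
        rw [abs_mul]
        exact mul_le_mul (X.norm_entry_le_entrywise_sup_norm (i := j) (j := k))
          (Y.norm_entry_le_entrywise_sup_norm (i := j) (j := k)) (abs_nonneg _) (norm_nonneg _)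
    _ = m * n * (‖X‖ * ‖Y‖) := by simp [mul_assoc]

theorem norm_sq_le_sum_frobInner (Z : Blocks N K) : ‖Z‖ ^ 2 ≤ ∑ i, frobInner (Z i) (Z i) := by
  have h0 : 0 ≤ ∑ i, frobInner (Z i) (Z i) :=
    Finset.sum_nonneg fun i _ => frobInner_self_nonneg _
  refine (Real.le_sqrt (norm_nonneg _) h0).mp ?_
  refine (pi_norm_le_iff_of_nonneg (Real.sqrt_nonneg _)).mpr fun i => Real.le_sqrt_of_sq_le ?_
  exact (norm_sq_le_frobInner _).trans <|
    Finset.single_le_sum (f := fun i => frobInner (Z i) (Z i))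
      (fun i _ => frobInner_self_nonneg _) (Finset.mem_univ i)

theorem dist_le_frobDist (Z W : Blocks N K) : dist Z W ≤ frobDist Z W := by
  rw [dist_eq_norm]
  exact Real.le_sqrt_of_sq_le (norm_sq_le_sum_frobInner (Z - W))

/-- The blocks of `Znew` before position `r` and those of `Zold` from position `r` on. -/
def hybrid (Znew Zold : Blocks N K) (r : ℕ) : Blocks N K :=
  fun j => if (j : ℕ) < r then Znew j else Zold j

theorem hybrid_zero (Znew Zold : Blocks N K) : hybrid Znew Zold 0 = Zold := by
  ext1 j
  simp [hybrid]

theorem hybrid_last (Znew Zold : Blocks N K) : hybrid Znew Zold (N - 1) = Znew := by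
  ext1 j
  simp [hybrid]

theorem norm_hybrid_sub_le (Znew Zold : Blocks N K) (r : ℕ) :
    ‖hybrid Znew Zold r - Znew‖ ≤ ‖Znew - Zold‖ := by
  refine (pi_norm_le_iff_of_nonneg (norm_nonneg _)).mpr fun j => ?_
  by_cases h : (j : ℕ) < r
  · simp [hybrid, h]
  · simp only [Pi.sub_apply, hybrid, h, if_false]
    rw [norm_sub_rev]
    exact norm_le_pi_norm (Znew - Zold) j

namespace Problem

variable (P : Problem K)

/-! ### The feasible set as a compact polyhedron. -/

section Constraints

/-- The linear maps of the equality constraints that define `S`. -/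
def eqMap : Fin K ⊕ Fin K ⊕ Unit → Matrix (Fin K) (Fin K) ℝ →ₗ[ℝ] ℝ :=
  Sum.elim
    (fun j =>
      { toFun := fun W => ∑ k, W j k * P.e k
        map_add' := fun X Y => by simp [add_mul, Finset.sum_add_distrib]
        map_smul' := fun c X => by simp [Finset.mul_sum, mul_assoc] })
    (Sum.elim
      (fun k =>
        { toFun := fun W => ∑ j, W j k * (P.e j * P.rho j)
          map_add' := fun X Y => by simp [add_mul, Finset.sum_add_distrib]
          map_smul' := fun c X => by simp [Finset.mul_sum, mul_assoc] })
      fun _ => Matrix.traceLinearMap (Fin K) ℝ ℝ)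

/-- The right-hand sides of the equality constraints that define `S`. -/
def eqVal : Fin K ⊕ Fin K ⊕ Unit → ℝ :=
  Sum.elim (fun _ => 1) (Sum.elim P.rho fun _ => 0)

theorem S_eq_polyhedron :
    P.S = polyhedron P.eqMap P.eqVal
      (fun a : Fin K × Fin K => Matrix.entryLinearMap ℝ ℝ a.1 a.2) := by
  ext W
  simp only [S, polyhedron, eqMap, eqVal, Set.mem_ofPred_eq, Sum.forall, Sum.elim_inl,
    Sum.elim_inr, Prod.forall, Matrix.entryLinearMap_apply, LinearMap.coe_mk, AddHom.coe_mk,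
    funext_iff, and_assoc, Matrix.traceLinearMap_apply, forall_const, Pi.one_apply]
  simp [Xi, Matrix.mulVec, dotProduct, Matrix.mul_apply, Matrix.diagonal, mul_assoc]

theorem feasible_eq_polyhedron :
    {Z : Blocks N K | P.Feasible Z} = polyhedron
      (fun c : Fin (N - 1) × (Fin K ⊕ Fin K ⊕ Unit) => P.eqMap c.2 ∘ₗ LinearMap.proj c.1)
      (fun c => P.eqVal c.2)
      (fun a : Fin (N - 1) × (Fin K × Fin K) =>
        Matrix.entryLinearMap ℝ ℝ a.2.1 a.2.2 ∘ₗ LinearMap.proj a.1) := by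
  ext Z
  simp only [Set.mem_ofPred_eq, Feasible, S_eq_polyhedron, polyhedron, Prod.forall, forall_and,
    LinearMap.comp_apply, LinearMap.proj_apply]

theorem mem_S_add_smul {X Y : Matrix (Fin K) (Fin K) ℝ} (hX : X ∈ P.S) (hY : Y ∈ P.S) {t : ℝ}
    (h0 : 0 ≤ t) (h1 : t ≤ 1) : X + t • (Y - X) ∈ P.S := by
  rw [S_eq_polyhedron] at *
  refine ⟨fun c => ?_, fun a => ?_⟩
  · simp [hX.1 c, hY.1 c]
  · have hx := hX.2 a
    have hy := hY.2 a
    simp only [map_add, map_smul, map_sub, smul_eq_mul]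
    nlinarith [mul_nonneg h0 hy, mul_nonneg (sub_nonneg.mpr h1) hx]

theorem isCompact_feasible (he : ∀ k, 0 < P.e k) : IsCompact {Z : Blocks N K | P.Feasible Z} := by
  refine Metric.isCompact_of_isClosed_isBounded ?_ ?_
  · rw [feasible_eq_polyhedron]
    have : ∀ f : Blocks N K →ₗ[ℝ] ℝ, Continuous f := fun f => f.continuous_of_finiteDimensional
    simp only [polyhedron, Set.ofPred_and, Set.ofPred_forall]
    exact (isClosed_iInter fun c => isClosed_eq (this _) continuous_const).inter
      (isClosed_iInter fun a => isClosed_le continuous_const (this _))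
  -- Nonnegativity and the row equations force `Z i j k ≤ 1 / e k`.
  · have hM : 0 ≤ ∑ k, (P.e k)⁻¹ := Finset.sum_nonneg fun k _ => (inv_pos.mpr (he k)).le
    refine isBounded_iff_forall_norm_le.mpr ⟨∑ k, (P.e k)⁻¹, fun Z hZ => ?_⟩
    refine (pi_norm_le_iff_of_nonneg hM).mpr fun i => (Matrix.norm_le_iff hM).mpr fun j k => ?_
    obtain ⟨h1, -, -, h4⟩ := hZ i
    have hsum : ∑ k, Z i j k * P.e k = 1 := congrFun h1 j
    have hle : Z i j k * P.e k ≤ 1 := hsum ▸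
      Finset.single_le_sum (f := fun k => Z i j k * P.e k)
        (fun k _ => mul_nonneg (h4 j k) (he k).le) (Finset.mem_univ k)
    rw [Real.norm_eq_abs, abs_of_nonneg (h4 j k)]
    calc Z i j k ≤ (P.e k)⁻¹ := by
          rw [← one_div]
          exact (le_div_iff₀ (he k)).mpr hle
      _ ≤ ∑ k, (P.e k)⁻¹ :=
          Finset.single_le_sum (f := fun k => (P.e k)⁻¹)
            (fun k _ => (inv_pos.mpr (he k)).le) (Finset.mem_univ k)

end Constraints

/-! ### The penalized energy as a quadratic function. -/

section Objective

/-- The interaction of two blocks in the penalized energy. -/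
noncomputable def pairForm :
    Matrix (Fin K) (Fin K) ℝ →ₗ[ℝ] Matrix (Fin K) (Fin K) ℝ →ₗ[ℝ] ℝ :=
  LinearMap.mk₂ ℝ
    (fun X Y => frobBilin K K X (P.Xi * P.Lam * Y * P.Xi * P.C * P.Xi) +
      P.beta * frobBilin K K X Y)
    (fun X X' Y => by simp only [map_add, LinearMap.add_apply]; ring)
    (fun c X Y => by simp only [map_smul, LinearMap.smul_apply, smul_eq_mul]; ring)
    (fun X Y Y' => by simp only [Matrix.mul_add, Matrix.add_mul, map_add]; ring)
    (fun c X Y => by simp only [Matrix.mul_smul, Matrix.smul_mul, map_smul, smul_eq_mul]; ring)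

/-- The linear part of the penalized energy. -/
noncomputable def linPart (N : ℕ) : Blocks N K →L[ℝ] ℝ :=
  LinearMap.toContinuousLinearMap
    (∑ i, (frobBilin K K).flip (P.Lam * P.Xi * P.C * P.Xi) ∘ₗ LinearMap.proj i)

/-- The Hessian of the penalized energy. -/
noncomputable def hessian (N : ℕ) : Blocks N K →L[ℝ] Blocks N K →L[ℝ] ℝ :=
  LinearMap.toContinuousBilinearMap <| LinearMap.mk₂ ℝ
    (fun Z W : Blocks N K => ∑ i, ∑ j ∈ Finset.Ioi i,
      (P.pairForm (Z i) (W j) + P.pairForm (W i) (Z j)))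
    (fun Z Z' W => by
      simp only [Pi.add_apply, map_add, LinearMap.add_apply, ← Finset.sum_add_distrib]
      exact Finset.sum_congr rfl fun i _ => Finset.sum_congr rfl fun j _ => by ring)
    (fun c Z W => by
      simp only [Pi.smul_apply, map_smul, LinearMap.smul_apply, Finset.smul_sum, smul_add])
    (fun Z W W' => by
      simp only [Pi.add_apply, map_add, LinearMap.add_apply, ← Finset.sum_add_distrib]
      exact Finset.sum_congr rfl fun i _ => Finset.sum_congr rfl fun j _ => by ring)
    (fun c Z W => by
      simp only [Pi.smul_apply, map_smul, LinearMap.smul_apply, Finset.smul_sum, smul_add])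

theorem hessian_apply (Z W : Blocks N K) :
    P.hessian N Z W = ∑ i, ∑ j ∈ Finset.Ioi i,
      (P.pairForm (Z i) (W j) + P.pairForm (W i) (Z j)) :=
  rfl

theorem hessian_comm (Z W : Blocks N K) : P.hessian N Z W = P.hessian N W Z := by
  simp only [hessian_apply, add_comm]

/-- Only pairs of distinct blocks interact. Hence the energy is affine in each block. -/
theorem hessian_single_single (i : Fin (N - 1)) (X Y : Matrix (Fin K) (Fin K) ℝ) :
    P.hessian N (Pi.single i X) (Pi.single i Y) = 0 := by
  rw [hessian_apply]
  refine Finset.sum_eq_zero fun a _ => Finset.sum_eq_zero fun b hb => ?_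
  have hab : a < b := Finset.mem_Ioi.mp hb
  by_cases h : a = i
  · have hb' : b ≠ i := fun h' => hab.ne (h.trans h'.symm)
    simp [Pi.single_eq_of_ne hb']
  · simp [Pi.single_eq_of_ne h]

theorem penalized_eq_quad (Z : Blocks N K) :
    P.penalized Z = quad (P.linPart N) (P.hessian N) Z := by
  have h1 : P.linPart N Z = ∑ i, frobInner (Z i) (P.Lam * P.Xi * P.C * P.Xi) := by
    simp [linPart]
  have h2 : P.hessian N Z Z = 2 * ∑ i, ∑ j ∈ Finset.Ioi i, P.pairForm (Z i) (Z j) := by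
    simp only [hessian_apply, Finset.mul_sum, two_mul]
  have h3 : ∀ X Y, P.pairForm X Y =
      frobInner X (P.Xi * P.Lam * Y * P.Xi * P.C * P.Xi) + P.beta * frobInner X Y :=
    fun _ _ => rfl
  rw [quad, h1, h2, penalized, energy]
  simp only [h3, Finset.sum_add_distrib, Finset.mul_sum]
  ring_nf

theorem penalized_add_single (Z : Blocks N K) (i : Fin (N - 1)) (D : Matrix (Fin K) (Fin K) ℝ) :
    P.penalized (Z + Pi.single i D) =
      P.penalized Z + (P.linPart N (Pi.single i D) + P.hessian N Z (Pi.single i D)) := by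
  rw [penalized_eq_quad, penalized_eq_quad, quad_add P.hessian_comm, hessian_single_single]
  ring

theorem blockGrad_apply (Z : Blocks N K) (i : Fin (N - 1)) (j k : Fin K) :
    P.blockGrad Z i j k = P.linPart N (Pi.single i (Matrix.single j k 1)) +
      P.hessian N Z (Pi.single i (Matrix.single j k 1)) := by
  rw [blockGrad, Matrix.of_apply]
  refine HasLineDerivAt.lineDeriv ?_
  have h : (fun t : ℝ => P.penalized
      (Z + t • (Pi.single i (Matrix.single j k 1) : Blocks N K))) =
      fun t => P.penalized Z + t * (P.linPart N (Pi.single i (Matrix.single j k 1)) +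
        P.hessian N Z (Pi.single i (Matrix.single j k 1))) := by
    funext t
    rw [← Pi.single_smul, penalized_add_single, Pi.single_smul, map_smul, map_smul, smul_eq_mul,
      smul_eq_mul, mul_add]
  rw [HasLineDerivAt, h]
  simpa using ((hasDerivAt_id (0 : ℝ)).mul_const _).const_add (P.penalized Z)

end Objective

/-! ### From the variational inequality to multipliers. -/

section Stationarity

theorem feasible_add_single {Z : Blocks N K} (hZ : P.Feasible Z) (i : Fin (N - 1))
    {X : Matrix (Fin K) (Fin K) ℝ} (hX : X ∈ P.S) :
    P.Feasible (Z + Pi.single i (X - Z i)) := fun j => by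
  by_cases h : j = i
  · subst h
    simpa using hX
  · simpa [Pi.single_eq_of_ne h] using hZ j

/-- Feasibility is a product condition, so one block can be varied alone. The block gradient is then
nonnegative on its feasible directions, and Farkas' lemma yields multipliers, with sign multipliers
only at vanishing entries, which gives complementary slackness. -/
theorem isKKT_of_stationary {Z : Blocks N K} (hZ : P.Feasible Z)
    (h : ∀ W, P.Feasible W → 0 ≤ P.linPart N (W - Z) + P.hessian N Z (W - Z)) : P.IsKKT Z := by
  classical
  have key : ∀ i, ∃ (ψ : Fin K ⊕ Fin K ⊕ Unit → ℝ) (φ : Fin K × Fin K → ℝ), (∀ a, 0 ≤ φ a) ∧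
      ∀ D : Matrix (Fin K) (Fin K) ℝ,
        P.linPart N (Pi.single i D) + P.hessian N Z (Pi.single i D) =
          ∑ c, ψ c * P.eqMap c D +
            ∑ a ∈ Finset.univ.filter (fun a : Fin K × Fin K => Z i a.1 a.2 = 0),
              φ a * D a.1 a.2 := by
    intro i
    refine farkas_eq (Finset.univ.filter fun a : Fin K × Fin K => Z i a.1 a.2 = 0) P.eqMap
      (fun a => Matrix.entryLinearMap ℝ ℝ a.1 a.2)
      ((P.linPart N + P.hessian N Z).toLinearMap ∘ₗ
        LinearMap.single ℝ (fun _ => Matrix (Fin K) (Fin K) ℝ) i) fun D hq hp => ?_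
    have hZi := hZ i
    rw [S_eq_polyhedron] at hZi
    obtain ⟨t, ht, hmem⟩ := exists_pos_add_smul_mem_polyhedron hZi hq fun a ha =>
      hp a (by simpa using ha)
    rw [← S_eq_polyhedron] at hmem
    have h1 := h _ (P.feasible_add_single hZ i hmem)
    simp only [add_sub_cancel_left, Pi.single_smul, map_smul, smul_eq_mul, ← mul_add] at h1
    exact nonneg_of_mul_nonneg_right h1 ht
  choose ψ φ hφ hG using key
  refine ⟨hZ, fun i j => ψ i (.inl j), fun i k => ψ i (.inr (.inl k)),
    fun i => ψ i (.inr (.inr ())),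
    fun i => Matrix.of fun j k => if Z i j k = 0 then φ i (j, k) else 0, fun i => ?_,
    fun i j k => ?_, fun i => ?_⟩
  · ext j k
    rw [blockGrad_apply, hG i]
    simp only [Fintype.sum_sum_type, Finset.univ_unique, Finset.sum_singleton, eqMap,
      Sum.elim_inl, Sum.elim_inr, LinearMap.coe_mk, AddHom.coe_mk, Matrix.traceLinearMap_apply,
      Finset.sum_filter, Fintype.sum_prod_type, Matrix.add_apply, Matrix.vecMulVec_apply,
      Matrix.smul_apply, Matrix.of_apply, Xi, Matrix.mulVec_diagonal, smul_eq_mul]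
    have h1 : ∀ a, ∑ b, Matrix.single j k (1 : ℝ) a b * P.e b = if j = a then P.e k else 0 := by
      intro a
      simp [Matrix.single_apply, ite_and]
    have h2 : ∀ b, ∑ a, Matrix.single j k (1 : ℝ) a b * (P.e a * P.rho a) =
        if k = b then P.e j * P.rho j else 0 := by
      intro b
      simp [Matrix.single_apply, ite_and]
    have h3 : (∑ a, ∑ b, if Z i a b = 0 then φ i (a, b) * Matrix.single j k (1 : ℝ) a b else 0) =
        if Z i j k = 0 then φ i (j, k) else 0 := by
      rw [Finset.sum_eq_single j _ (by simp), Finset.sum_eq_single k _ (by simp)]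
      · simp
      · intro b _ hb
        simp [hb.symm]
      · intro a _ ha
        simp [ha.symm]
    have h4 : (Matrix.single j k (1 : ℝ)).trace = (1 : Matrix (Fin K) (Fin K) ℝ) j k := by
      by_cases hjk : j = k
      · subst hjk
        simp
      · simp [Matrix.trace_single_eq_of_ne, hjk]
    simp only [h1, h2, h3, h4, mul_ite, mul_zero, Finset.sum_ite_eq, Finset.mem_univ, if_true]
    simp
    ring
  · simp only [Matrix.of_apply]
    split_ifs
    · exact hφ i _
    · exact le_rfl
  · refine Finset.sum_eq_zero fun j _ => Finset.sum_eq_zero fun k _ => ?_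
    by_cases h0 : Z i j k = 0 <;> simp [h0]

end Stationarity

/-! ### Estimates for the proximal iteration and conclusion. -/

section PBCD

variable {σ : ℝ}

/-- Recentring at the new block puts the base point at position `i + 1` in the chain of hybrids,
since block `i` is already updated. -/
theorem blockObjective_add (Znew Zold : Blocks N K) (i : Fin (N - 1))
    (D : Matrix (Fin K) (Fin K) ℝ) :
    P.blockObjective σ Znew Zold i (Znew i + D) =
      P.penalized (hybrid Znew Zold (i + 1) + Pi.single i D) +
        σ / 2 * frobInner (Znew i - Zold i + D) (Znew i - Zold i + D) := by
  rw [blockObjective, sub_add_eq_add_sub]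
  congr 2
  funext j
  rcases lt_trichotomy j i with h | h | h
  · have h' : (j : ℕ) < i + 1 := by have : (j : ℕ) < i := h; omega
    simp [hybrid, h, h', Pi.single_eq_of_ne h.ne]
  · subst h
    simp [hybrid]
  · have h' : ¬ (j : ℕ) < i + 1 := by have : (i : ℕ) < j := h; omega
    simp [hybrid, h.not_gt, h.ne', h']

theorem hybrid_succ_add_single (Znew Zold : Blocks N K) (i : Fin (N - 1)) :
    hybrid Znew Zold (i + 1) + Pi.single i (Zold i - Znew i) = hybrid Znew Zold i := by
  funext j
  rcases lt_trichotomy j i with h | h | h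
  · have h'' : (j : ℕ) < i := h
    have h' : (j : ℕ) < i + 1 := by omega
    simp [hybrid, h', h'', Pi.single_eq_of_ne h.ne]
  · subst h
    simp [hybrid]
  · have h'' : (i : ℕ) < j := h
    have h' : ¬ (j : ℕ) < i + 1 := by omega
    simp only [hybrid, h', Pi.add_apply, Pi.single_eq_of_ne h.ne', h''.not_gt, if_false, add_zero]

theorem nonneg_of_forall_mul_add_sq_mul_nonneg {A Q : ℝ}
    (h : ∀ t : ℝ, 0 < t → t ≤ 1 → 0 ≤ t * A + t ^ 2 * Q) : 0 ≤ A := by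
  have h1 : ∀ᶠ t : ℝ in 𝓝[>] 0, 0 ≤ A + t * Q := by
    filter_upwards [Ioc_mem_nhdsGT (zero_lt_one' ℝ)] with t ht
    refine nonneg_of_mul_nonneg_right (a := t) ?_ ht.1
    linarith [h t ht.1 ht.2]
  have h2 : Tendsto (fun t : ℝ => A + t * Q) (𝓝[>] 0) (𝓝 A) := by
    have : Continuous fun t : ℝ => A + t * Q := by fun_prop
    simpa using (this.tendsto 0).mono_left nhdsWithin_le_nhds
  exact ge_of_tendsto h2 h1

variable {Z : ℕ → Blocks N K} {P}

theorem IsExactPBCD.feasible_succ (hZ : P.IsExactPBCD σ Z) (k : ℕ) : P.Feasible (Z (k + 1)) :=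
  fun i => (hZ k i).1

/-- First-order optimality along the segment from the minimizer to `X`; only the proximal term
contributes at order `t²`. -/
theorem IsExactPBCD.block_variational (hZ : P.IsExactPBCD σ Z) (k : ℕ) (i : Fin (N - 1))
    {X : Matrix (Fin K) (Fin K) ℝ} (hX : X ∈ P.S) :
    0 ≤ P.linPart N (Pi.single i (X - Z (k + 1) i)) +
      P.hessian N (hybrid (Z (k + 1)) (Z k) (i + 1)) (Pi.single i (X - Z (k + 1) i)) +
      σ * frobInner (Z (k + 1) i - Z k i) (X - Z (k + 1) i) := by
  obtain ⟨hmem, hmin⟩ := hZ k i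
  refine nonneg_of_forall_mul_add_sq_mul_nonneg
    (Q := σ / 2 * frobInner (X - Z (k + 1) i) (X - Z (k + 1) i)) fun t h0 h1 => ?_
  have h2 := hmin _ (P.mem_S_add_smul hmem hX h0.le h1)
  have h3 := P.blockObjective_add (σ := σ) (Z (k + 1)) (Z k) i 0
  rw [add_zero, add_zero, Pi.single_zero, add_zero] at h3
  rw [blockObjective_add, h3, penalized_add_single, frobInner_self_add_smul, Pi.single_smul,
    map_smul, map_smul, smul_eq_mul, smul_eq_mul] at h2
  linarith

/-- The old block is an admissible competitor when `Z k` is feasible; the resulting inequalities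
telescope along the hybrids. -/
theorem IsExactPBCD.descent (hσ : 0 < σ) (hZ : P.IsExactPBCD σ Z) {k : ℕ}
    (hk : P.Feasible (Z k)) :
    P.penalized (Z (k + 1)) + σ / 2 * ‖Z (k + 1) - Z k‖ ^ 2 ≤ P.penalized (Z k) := by
  have hstep : ∀ i : Fin (N - 1), σ / 2 * frobInner (Z (k + 1) i - Z k i) (Z (k + 1) i - Z k i) ≤
      P.penalized (hybrid (Z (k + 1)) (Z k) i) -
        P.penalized (hybrid (Z (k + 1)) (Z k) (i + 1)) := fun i => by
    have h1 := (hZ k i).2 _ (hk i)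
    have h2 := P.blockObjective_add (σ := σ) (Z (k + 1)) (Z k) i 0
    have h3 := P.blockObjective_add (σ := σ) (Z (k + 1)) (Z k) i (Z k i - Z (k + 1) i)
    rw [add_zero, add_zero, Pi.single_zero, add_zero] at h2
    rw [hybrid_succ_add_single, add_sub_cancel, sub_add_sub_cancel, sub_self] at h3
    have h4 : frobInner (0 : Matrix (Fin K) (Fin K) ℝ) 0 = 0 := by simp [frobInner]
    rw [h2, h3, h4] at h1
    linarith
  have hsum := Finset.sum_le_sum fun i (_ : i ∈ Finset.univ) => hstep i
  rw [Fin.sum_univ_eq_sum_range (fun r => P.penalized (hybrid (Z (k + 1)) (Z k) r) -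
    P.penalized (hybrid (Z (k + 1)) (Z k) (r + 1))), Finset.sum_range_sub', hybrid_zero,
    hybrid_last, ← Finset.mul_sum] at hsum
  have h1 := norm_sq_le_sum_frobInner (Z (k + 1) - Z k)
  have h2 := mul_le_mul_of_nonneg_left h1 (by positivity : 0 ≤ σ / 2)
  simp only [Pi.sub_apply] at h2
  linarith

/-- Each block condition holds at a hybrid point. Moving to `Z (k + 1)` costs the Hessian norm times
the step, the proximal term costs `σ K²` times the step, and summing over blocks gives the factor `N
- 1`. -/
theorem IsExactPBCD.residual (hσ : 0 < σ) (hZ : P.IsExactPBCD σ Z) (k : ℕ) {W : Blocks N K}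
    (hW : P.Feasible W) :
    -((N - 1 : ℕ) * (‖P.hessian N‖ + σ * (K * K)) * ‖Z (k + 1) - Z k‖ * ‖W - Z (k + 1)‖) ≤
      P.linPart N (W - Z (k + 1)) + P.hessian N (Z (k + 1)) (W - Z (k + 1)) := by
  set D := W - Z (k + 1) with hD
  set s := ‖Z (k + 1) - Z k‖ with hs
  have hblock : ∀ i : Fin (N - 1), -((‖P.hessian N‖ + σ * (K * K)) * s * ‖D‖) ≤
      P.linPart N (Pi.single i (D i)) + P.hessian N (Z (k + 1)) (Pi.single i (D i)) := fun i => by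
    have h1 := hZ.block_variational k i (hW i)
    have hDi : ‖D i‖ ≤ ‖D‖ := norm_le_pi_norm D i
    have h2 : P.hessian N (hybrid (Z (k + 1)) (Z k) (i + 1) - Z (k + 1)) (Pi.single i (D i)) ≤
        ‖P.hessian N‖ * s * ‖D‖ := by
      refine (le_abs_self _).trans (((P.hessian N).le_opNorm₂ _ _).trans ?_)
      gcongr
      · exact norm_hybrid_sub_le _ _ _
      · rwa [Pi.norm_single]
    have h3 : frobInner (Z (k + 1) i - Z k i) (D i) ≤ K * K * (s * ‖D‖) := by
      refine (le_abs_self _).trans ((abs_frobInner_le _ _).trans ?_)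
      gcongr
      exact norm_le_pi_norm (Z (k + 1) - Z k) i
    have h4 := mul_le_mul_of_nonneg_left h3 hσ.le
    rw [map_sub, sub_apply] at h2
    simp only [hD, Pi.sub_apply] at *
    linarith
  have hsum := Finset.sum_le_sum fun i (_ : i ∈ Finset.univ) => hblock i
  rw [Finset.sum_add_distrib, ← map_sum, ← map_sum, Finset.univ_sum_single] at hsum
  simp only [Finset.sum_const, Finset.card_univ, Fintype.card_fin, nsmul_eq_mul] at hsum
  linarith

theorem IsExactPBCD.isDescentSeq (hσ : 0 < σ) (hZ : P.IsExactPBCD σ Z) (h0 : P.Feasible (Z 0)) :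
    IsDescentSeq {Z : Blocks N K | P.Feasible Z} (P.linPart N) (P.hessian N) (σ / 2)
      ((N - 1 : ℕ) * (‖P.hessian N‖ + σ * (K * K))) Z := by
  have hmem : ∀ k, P.Feasible (Z k) := fun k => by
    cases k with
    | zero => exact h0
    | succ k => exact hZ.feasible_succ k
  refine ⟨hmem, fun k => ?_, fun k W hW => hZ.residual hσ k hW⟩
  rw [← penalized_eq_quad, ← penalized_eq_quad]
  exact hZ.descent hσ (hmem k)

variable (P)

theorem exists_isKKT_tendsto (he : ∀ k, 0 < P.e k) (hσ : 0 < σ) (hZ : P.IsExactPBCD σ Z) :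
    ∃ Zlim : Blocks N K, P.IsKKT Zlim ∧ Tendsto Z atTop (𝓝 Zlim) := by
  -- `Z 0` may be infeasible, but every later iterate is feasible.
  have hshift : P.IsExactPBCD σ fun k => Z (k + 1) := fun k i => hZ (k + 1) i
  have hseq := hshift.isDescentSeq hσ (hZ.feasible_succ 0)
  have hF := P.isCompact_feasible (N := N) he
  simp only [feasible_eq_polyhedron] at hseq hF
  obtain ⟨x, hx, hlim, hstat⟩ := hseq.exists_tendsto hF P.hessian_comm (by positivity)
    (by positivity)
  rw [← feasible_eq_polyhedron] at hx hstat
  exact ⟨x, P.isKKT_of_stationary hx hstat, (tendsto_add_atTop_iff_nat 1).mp hlim⟩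

theorem exists_isGlobalMinimizer_tendsto (he : ∀ k, 0 < P.e k) (hσ : 0 < σ) :
    ∃ δ : ℝ, 0 < δ ∧ ∀ Z : ℕ → Blocks N K, P.IsExactPBCD σ Z → P.Feasible (Z 0) →
      (∃ Zstar : Blocks N K, P.IsGlobalMinimizer Zstar ∧ frobDist (Z 0) Zstar < δ) →
      ∃ Zlim : Blocks N K, P.IsGlobalMinimizer Zlim ∧ Tendsto Z atTop (𝓝 Zlim) := by
  have hF := P.isCompact_feasible (N := N) he
  rw [feasible_eq_polyhedron] at hF
  obtain ⟨δ, hδ, h⟩ := exists_tendsto_isMinOn (l := P.linPart N)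
    (L := (N - 1 : ℕ) * (‖P.hessian N‖ + σ * (K * K))) hF P.hessian_comm (half_pos hσ)
    (by positivity)
  rw [← feasible_eq_polyhedron] at h
  refine ⟨δ, hδ, fun Z hZ h0 ⟨Zs, ⟨hs, hmin⟩, hd⟩ => ?_⟩
  obtain ⟨x, hx, hxmin, hlim⟩ := h Z (hZ.isDescentSeq hσ h0)
    ⟨Zs, hs, fun W hW => by
      simpa only [Set.mem_ofPred_eq, ← penalized_eq_quad] using hmin W hW,
      (dist_le_frobDist _ _).trans_lt hd⟩
  refine ⟨x, ⟨hx, fun W hW => ?_⟩, hlim⟩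
  rw [penalized_eq_quad, penalized_eq_quad]
  exact hxmin hW

end PBCD

end Problem

end Blocks

end PenalizedMMOT
theorem theorem3p1 {N K : ℕ} (hN : 2 ≤ N) (P : PenalizedMMOT.Problem K)
    (he : ∀ k, 0 < P.e k) (hrho : ∀ k, 0 ≤ P.rho k) (hbeta : 0 < P.beta)
    (σ : ℝ) (hσ : 0 < σ) :
    (∀ Z : ℕ → PenalizedMMOT.Blocks N K, P.IsExactPBCD σ Z →
      ∃ Zlim : PenalizedMMOT.Blocks N K, P.IsKKT Zlim ∧ Tendsto Z atTop (𝓝 Zlim)) ∧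
    (∃ δ : ℝ, 0 < δ ∧
      ∀ Z : ℕ → PenalizedMMOT.Blocks N K, P.IsExactPBCD σ Z → P.Feasible (Z 0) →
        (∃ Zstar : PenalizedMMOT.Blocks N K,
          P.IsGlobalMinimizer Zstar ∧ PenalizedMMOT.frobDist (Z 0) Zstar < δ) →
        ∃ Zlim : PenalizedMMOT.Blocks N K,
          P.IsGlobalMinimizer Zlim ∧ Tendsto Z atTop (𝓝 Zlim)) :=
  ⟨fun _ hZ => P.exists_isKKT_tendsto he hσ hZ, P.exists_isGlobalMinimizer_tendsto he hσ⟩
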